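/- All locally convex spaces are Hausdorff and over $\mathbb F\in\{\mathbb R,\mathbb C\}$; $E'$ denotes the topological dual of $E$. Let $p\in[1,\infty]$. A sequence $(x_n)$ in $E$ is *weakly $p$-summable* if for every $\chi\in E'$ the sequence $(\chi(x_n))_n$ belongs to $\ell_p$ (if $p<\infty$) or to $c_0$ (if $p=\infty$); it is *weakly $p$-convergent* to $x\in E$ if $(x_n-x)$ is weakly $p$-summable. A subset $A\subseteq E$ is *relatively weakly sequentially $p$-compact* if every sequence in $A$ has a subsequence that is weakly $p$-convergent to a point of $E$. The space $E$ is *weakly $p$-angelic* if the relatively weakly sequentially $p$-compact subsets of $E$ are exactly the relatively weakly compact ones and every weakly compact subset of $E$ is Fréchet–Urysohn in the weak topology. The space $E$ is *locally complete* if the closed absolutely convex hull of every null sequence in $E$ is compact. A non-empty subset $A$ of a locally convex space $H$ is *$(p,\infty)$-limited* if $\sup_{a\in A}|\chi_n(a)|\to0$ for every sequence $(\chi_n)$ in $H'$ that is weak$^*$ $p$-summable, i.e. weakly $p$-summable in $(H',\sigma(H',H))$. A subset $A\subseteq H$ is *precompact* if for every neighbourhood $U$ of zero there is a finite set $F\subseteq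 H$ with $A\subseteq F+U$. The Mackey topology $\mu(E',E)$ is the finest locally convex vector topology on $E'$ whose continuous linear functionals are exactly the evaluations at points of $E$. **Theorem.** Let $p\in[1,\infty]$, let $E$ be a weakly $p$-angelic and locally complete locally convex space, and let $H=(E',\mu(E',E))$. Then a non-empty bounded subset $B$ of $H$ is precompact if and only if it is a $(p,\infty)$-limited subset of $H$. -/

import Mathlib

open Filter Topology
open scoped ENNReal Pointwise

/-- A scalar sequence belongs to `ℓ_p` (for `p < ∞`), or to `c₀` (for `p = ∞`). -/
def IsEllSeq {𝕜 : Type*} [RCLike 𝕜] (p : ℝ≥0∞) (a : ℕ → 𝕜) : Prop :=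
  (p ≠ ∞ → Memℓp a p) ∧ (p = ∞ → Tendsto a atTop (𝓝 0))

/-- A sequence with values in `[0, ∞]` belongs to `ℓ_q` (for `q < ∞`), or tends to `0`
(for `q = ∞`). -/
def IsEllSeqENNReal (q : ℝ≥0∞) (a : ℕ → ℝ≥0∞) : Prop :=
  (q ≠ ∞ → ∑' n, a n ^ q.toReal ≠ ∞) ∧ (q = ∞ → Tendsto a atTop (𝓝 0))

section Sequences

variable (𝕜 : Type*) [RCLike 𝕜] {X : Type*} [AddCommGroup X] [Module 𝕜 X] [TopologicalSpace X]

/-- Weakly `p`-summable sequences in a topological vector space `X`. -/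
def IsWeaklyPSummable (p : ℝ≥0∞) (x : ℕ → X) : Prop :=
  ∀ χ : StrongDual 𝕜 X, IsEllSeq p (fun n => χ (x n))

/-- The sequence `x` is weakly `p`-convergent to `a`. -/
def IsWeaklyPConvergent (p : ℝ≥0∞) (x : ℕ → X) (a : X) : Prop :=
  IsWeaklyPSummable 𝕜 p (fun n => x n - a)

/-- Every sequence in `A` has a subsequence which is weakly `p`-convergent to a point of `X`. -/
def IsRelWeaklySeqPCompact (p : ℝ≥0∞) (A : Set X) : Prop :=
  ∀ x : ℕ → X, (∀ n, x n ∈ A) →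
    ∃ a : X, ∃ φ : ℕ → ℕ, StrictMono φ ∧ IsWeaklyPConvergent 𝕜 p (x ∘ φ) a

/-- The closure of `A` in the weak topology of `X` is weakly compact. -/
def IsRelWeaklyCompact (A : Set X) : Prop :=
  IsCompact (closure (toWeakSpace 𝕜 X '' A))

/-- `‖χ‖_A = sup {|χ(x)| : x ∈ A ∪ {0}}`, as an element of `[0, ∞]`. -/
noncomputable def supOn (A : Set X) (χ : WeakDual 𝕜 X) : ℝ≥0∞ :=
  ⨆ x ∈ A ∪ {0}, ‖χ x‖ₑ

/-- `A` is a `(p, q)`-limited set: it is non-empty, and `(‖χₙ‖_A)` is in `ℓ_q` (tends to `0` if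
`q = ∞`) for every sequence `χ` in `X'` which is weak* `p`-summable, that is, weakly `p`-summable
in the space `X'` with its weak* topology. -/
def IsPQLimited (p q : ℝ≥0∞) (A : Set X) : Prop :=
  A.Nonempty ∧ ∀ χ : ℕ → WeakDual 𝕜 X, IsWeaklyPSummable 𝕜 p χ →
    IsEllSeqENNReal q (fun n => supOn 𝕜 A (χ n))

end Sequences

/-- `A` is precompact: for every neighbourhood `U` of zero there is a finite set `F` with
`A ⊆ F + U`. -/
def IsPrecompactSet {X : Type*} [AddCommGroup X] [TopologicalSpace X] (A : Set X) : Prop :=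
  ∀ U ∈ 𝓝 (0 : X), ∃ F : Set X, F.Finite ∧ A ⊆ F + U

section Spaces

variable (𝕜 : Type*) [RCLike 𝕜] (E : Type*) [AddCommGroup E] [Module 𝕜 E] [TopologicalSpace E]

/-- The relatively weakly sequentially `p`-compact subsets of `E` are exactly its relatively
weakly compact subsets. -/
def IsWeaklySeqPAngelic (p : ℝ≥0∞) : Prop :=
  ∀ A : Set E, IsRelWeaklySeqPCompact 𝕜 p A ↔ IsRelWeaklyCompact 𝕜 A

/-- `E` is weakly `p`-angelic: it is weakly sequentially `p`-angelic, and every weakly compact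
subset of `E`, with the weak topology, is a Fréchet–Urysohn space. -/
def IsWeaklyPAngelic (p : ℝ≥0∞) : Prop :=
  IsWeaklySeqPAngelic 𝕜 E p ∧
    ∀ K : Set (WeakSpace 𝕜 E), IsCompact K → FrechetUrysohnSpace K

/-- `E` is locally complete: the closed absolutely convex hull of every null sequence in `E` is
compact. (The absolutely convex hull of a set is the convex hull of its balanced hull.) -/
def IsLocallyCompleteSpace [Module ℝ E] : Prop :=
  ∀ x : ℕ → E, Tendsto x atTop (𝓝 0) →
    IsCompact (closure (convexHull ℝ (balancedHull 𝕜 (Set.range x))))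

/-- A topology `t` on the dual `E'` is a locally convex vector topology compatible with the pairing
of `E'` and `E`: its continuous linear functionals are exactly the evaluations at points of `E`. -/
def IsCompatibleDualTopology (t : TopologicalSpace (StrongDual 𝕜 E)) : Prop :=
  @IsTopologicalAddGroup (StrongDual 𝕜 E) t _ ∧
  @ContinuousSMul 𝕜 (StrongDual 𝕜 E) _ _ t ∧
  @LocallyConvexSpace ℝ (StrongDual 𝕜 E) _ _ _ _ t ∧
  ∀ f : StrongDual 𝕜 E →ₗ[𝕜] 𝕜,
    @Continuous (StrongDual 𝕜 E) 𝕜 t _ f ↔ ∃ x : E, ∀ χ : StrongDual 𝕜 E, f χ = χ x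

/-- The Mackey topology `μ(E', E)`: the finest locally convex vector topology on `E'` which is
compatible with the pairing of `E'` and `E`. In the order on `TopologicalSpace`, finer topologies
are smaller. -/
abbrev mackeyDualTopology : TopologicalSpace (StrongDual 𝕜 E) :=
  sInf {t | IsCompatibleDualTopology 𝕜 E t}

/-- The space `(E', μ(E', E))`: the topological dual of `E` with its Mackey topology. -/
def MackeyDual : Type _ := StrongDual 𝕜 E

namespace MackeyDual

noncomputable instance : AddCommGroup (MackeyDual 𝕜 E) :=
  inferInstanceAs (AddCommGroup (StrongDual 𝕜 E))

noncomputable instance : Module 𝕜 (MackeyDual 𝕜 E) :=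
  inferInstanceAs (Module 𝕜 (StrongDual 𝕜 E))

noncomputable instance : Module ℝ (MackeyDual 𝕜 E) :=
  inferInstanceAs (Module ℝ (StrongDual 𝕜 E))

instance : IsScalarTower ℝ 𝕜 (MackeyDual 𝕜 E) :=
  inferInstanceAs (IsScalarTower ℝ 𝕜 (StrongDual 𝕜 E))

instance : TopologicalSpace (MackeyDual 𝕜 E) := mackeyDualTopology 𝕜 E

instance : IsTopologicalAddGroup (MackeyDual 𝕜 E) :=
  topologicalAddGroup_sInf (G := StrongDual 𝕜 E) fun _ ht => ht.1

instance : ContinuousSMul 𝕜 (MackeyDual 𝕜 E) :=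
  continuousSMul_sInf (X := StrongDual 𝕜 E) fun _ ht => ht.2.1

instance : LocallyConvexSpace ℝ (MackeyDual 𝕜 E) :=
  LocallyConvexSpace.sInf (E := StrongDual 𝕜 E) fun _ ht => ht.2.2.1

end MackeyDual

end Spaces

/-!
The argument is duality between `E` and `H = (E', μ(E', E))`, and rests on identifying `H'` with
`E`. That `H'` consists of evaluations is the Mackey–Arens theorem (`MackeyDual.exists_eval`): by
Hahn–Banach, a functional continuous for a supremum of locally convex topologies is a finite sum of
functionals, each continuous for one of them (`mem_of_continuous_iInf`). Conversely, evaluations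
are Mackey continuous as soon as one compatible topology exists. For a locally complete `E` a
convenient one is the topology of uniform convergence on the weakly null sequences of `E`
(`IsLocallyCompleteSpace.isCompatible_weaklyNullTopology`): a functional bounded by
`χ ↦ C * supₙ ‖χ (x n)‖` extends to `ℓ^∞`, acts on `c₀` as some `l ∈ ℓ¹`, and is therefore the
evaluation at the weak sum of `∑ l n • x n`, which exists by local completeness
(`IsLocallyCompleteSpace.exists_weak_sum`).

Precompact sets are limited: a weak* `p`-summable sequence in `H'` is given by a weakly null
sequence of `E`; by the previous paragraph it is Mackey equicontinuous, and so converges to zero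
uniformly on precompact sets. This is where local completeness is essential.

Limited sets are precompact: a Mackey neighbourhood of zero contains a multiple of the polar of a
weakly compact set `K` of `E` (`isCompact_polar_of_forall_eval`). Sequences in `K` have weakly
`p`-convergent subsequences because `E` is weakly `p`-angelic, and these converge uniformly on the
limited set `B`. Hence `K` is totally bounded for uniform convergence on `B`, and as `B` is
pointwise bounded, `B` is totally bounded for uniform convergence on `K`
(`exists_finite_approx_swap`).
-/

/-! ### Dominated functionals -/

section HahnBanach

variable {𝕜 : Type*} [RCLike 𝕜] {V W : Type*} [AddCommGroup V] [Module 𝕜 V] [AddCommGroup W]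
  [Module 𝕜 W]

/-- **Hahn–Banach**: a linear functional dominated by the pullback of a seminorm along a linear map
`T` factors through `T`. -/
theorem exists_factor_of_le_seminorm (f : V →ₗ[𝕜] 𝕜) (T : V →ₗ[𝕜] W) (p : Seminorm 𝕜 W)
    (h : ∀ v, ‖f v‖ ≤ p (T v)) :
    ∃ g : W →ₗ[𝕜] 𝕜, (∀ w, ‖g w‖ ≤ p w) ∧ ∀ v, g (T v) = f v := by
  have hker : LinearMap.ker T ≤ LinearMap.ker f := fun v hv => by
    rw [LinearMap.mem_ker] at hv ⊢
    simpa [hv] using h v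
  let f' : LinearMap.range T →ₗ[𝕜] 𝕜 :=
    ((LinearMap.ker T).liftQ f hker).comp T.quotKerEquivRange.symm.toLinearMap
  have hf' : ∀ v, f' ⟨T v, v, rfl⟩ = f v := fun v => by
    have : T.quotKerEquivRange.symm ⟨T v, v, rfl⟩ = (LinearMap.ker T).mkQ v := by
      rw [LinearEquiv.symm_apply_eq]
      rfl
    simp [f', this]
  obtain ⟨g, hg, hgp⟩ := Module.Dual.exists_extension_of_le_seminorm (LinearMap.range T) f' (p := p)
    (by rintro ⟨_, v, rfl⟩; rw [hf']; exact h v)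
  exact ⟨g, hgp, fun v => (hg ⟨T v, v, rfl⟩).trans (hf' v)⟩

/-- A linear functional dominated by a finite sum of seminorms is a sum of functionals, each
dominated by one of them. -/
theorem exists_decomp_of_le_sum {ι : Type*} [Fintype ι] (f : V →ₗ[𝕜] 𝕜) (q : ι → Seminorm 𝕜 V)
    (h : ∀ v, ‖f v‖ ≤ ∑ i, q i v) :
    ∃ g : ι → V →ₗ[𝕜] 𝕜, (∀ i v, ‖g i v‖ ≤ q i v) ∧ f = ∑ i, g i := by
  classical
  have happ : ∀ w : ι → V, (∑ i, (q i).comp (LinearMap.proj (R := 𝕜) (φ := fun _ => V) i)) w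
      = ∑ i, q i (w i) := fun w => by simp
  obtain ⟨G, hG, hGf⟩ := exists_factor_of_le_seminorm f
    (LinearMap.pi fun _ : ι => LinearMap.id)
    (∑ i, (q i).comp (LinearMap.proj (R := 𝕜) (φ := fun _ => V) i))
    (fun v => by rw [happ]; exact h v)
  refine ⟨fun i => G ∘ₗ LinearMap.single 𝕜 (fun _ => V) i, fun i v => ?_, ?_⟩
  · refine (hG _).trans ?_
    rw [happ, Finset.sum_eq_single i] <;> simp +contextual
  · ext v
    rw [← hGf v]
    simp only [LinearMap.sum_apply, LinearMap.comp_apply, LinearMap.single_apply, ← map_sum]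
    congr 1
    ext i
    simp

/-- A seminorm is attained at each vector by a functional which it dominates. -/
theorem exists_functional_apply_eq_seminorm (q : Seminorm 𝕜 V) (v : V) :
    ∃ g : V →ₗ[𝕜] 𝕜, (∀ w, ‖g w‖ ≤ q w) ∧ g v = (q v : 𝕜) := by
  obtain ⟨g, hg, h⟩ := exists_factor_of_le_seminorm (((q v : ℝ) : 𝕜) • LinearMap.id)
    (LinearMap.toSpanSingleton 𝕜 V v) q
    (fun c => by
      simp [map_smul_eq_mul, RCLike.real_smul_eq_coe_mul, abs_of_nonneg, mul_comm])
  exact ⟨g, hg, by simpa [RCLike.real_smul_eq_coe_mul] using h 1⟩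

end HahnBanach

/-! ### Locally convex topologies and their seminorms -/

section Polynormable

variable {𝕜 : Type*} [RCLike 𝕜] {V : Type*} [AddCommGroup V] [Module 𝕜 V]

open scoped ComplexOrder in
theorem polynormableSpace_of_locallyConvexSpace_real [Module ℝ V] [IsScalarTower ℝ 𝕜 V]
    [TopologicalSpace V] [IsTopologicalAddGroup V] [ContinuousSMul 𝕜 V] [LocallyConvexSpace ℝ V] :
    PolynormableSpace 𝕜 V := by
  have : ContinuousSMul ℝ V := IsScalarTower.continuousSMul 𝕜
  have : LocallyConvexSpace 𝕜 V := by
    refine LocallyConvexSpace.ofBasisZero 𝕜 V _ _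
      (LocallyConvexSpace.convex_basis_zero ℝ V) fun s hs => ?_
    exact convex_of_nonneg_surjective_algebraMap _
        (fun _ => RCLike.nonneg_iff_exists_ofReal.mp) hs.2
  infer_instance

theorem continuous_linearMap_of_le_seminorm [TopologicalSpace V] [PolynormableSpace 𝕜 V]
    (f : V →ₗ[𝕜] 𝕜) (q : Seminorm 𝕜 V) (hq : Continuous q) (h : ∀ v, ‖f v‖ ≤ q v) :
    Continuous f :=
  (PolynormableSpace.withSeminorms 𝕜 V).continuous_normedSpace_rng 𝕜 f
    ⟨{⟨q, hq⟩}, 1, fun v => by simpa using h v⟩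

theorem exists_continuous_seminorm_of_mem_nhds_zero [TopologicalSpace V] [PolynormableSpace 𝕜 V]
    {U : Set V} (hU : U ∈ 𝓝 (0 : V)) :
    ∃ q : Seminorm 𝕜 V, Continuous q ∧ ∃ r > 0, ∀ v, q v < r → v ∈ U := by
  have hw := PolynormableSpace.withSeminorms 𝕜 V
  have := hw.topologicalAddGroup
  obtain ⟨s, r, hr, h⟩ := (hw.mem_nhds_iff 0 U).1 hU
  refine ⟨s.sup fun p : {p : Seminorm 𝕜 V // Continuous p} => p.1,
    Seminorm.continuous_finsetSup fun i _ => i.2, r, hr, fun v hv => h ?_⟩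
  simpa [Seminorm.mem_ball_zero] using hv

/-- A functional which is continuous for the supremum of a family of locally convex topologies is
a finite sum of functionals, each of them continuous for one member of the family: it lies in
every subspace containing all of these. Finer topologies are smaller in Mathlib's order, so the
supremum is written `⨅`. -/
theorem mem_of_continuous_iInf {ι : Type*} {t : ι → TopologicalSpace V}
    (ht : ∀ i, PolynormableSpace 𝕜 V (topology := t i)) (D : Submodule 𝕜 (V →ₗ[𝕜] 𝕜))
    (hD : ∀ i, ∀ g : V →ₗ[𝕜] 𝕜, Continuous[t i, inferInstance] g → g ∈ D)
    (f : V →ₗ[𝕜] 𝕜) (hf : Continuous[⨅ i, t i, inferInstance] f) : f ∈ D := by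
  let _ : TopologicalSpace V := ⨅ i, t i
  have hw : WithSeminorms (SeminormFamily.sigma fun i
      (p : {p : Seminorm 𝕜 V // Continuous[t i, inferInstance] p}) => p.1) :=
    withSeminorms_iInf fun i => (ht i).withSeminorms'
  obtain ⟨s, C, -, hC⟩ := Seminorm.bound_of_continuous hw f.toSeminorm hf.norm
  obtain ⟨g, hg, rfl⟩ := exists_decomp_of_le_sum f (fun j : s => C • j.1.2.1) fun v => by
    refine (hC v).trans ?_
    have := Seminorm.finset_sup_le_sum
      (SeminormFamily.sigma fun i
        (p : {p : Seminorm 𝕜 V // Continuous[t i, inferInstance] p}) => p.1) s v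
    refine (mul_le_mul_of_nonneg_left this C.2).trans (le_of_eq ?_)
    simp only [FunLike.coe_sum, Finset.sum_apply]
    rw [Finset.mul_sum, ← Finset.sum_coe_sort]
    rfl
  refine Submodule.sum_mem _ fun j _ => hD j.1.1 _ ?_
  let _ := t j.1.1
  have := ht j.1.1
  exact continuous_linearMap_of_le_seminorm (g j) (C • j.1.2.1) (j.1.2.2.const_smul C) (hg j)

end Polynormable

/-! ### Functionals on null sequences and absolutely summable sequences -/

section NullSequences

variable {𝕜 : Type*} [RCLike 𝕜]

/-- The dual of `c₀` is `ℓ¹`: a bounded functional on `ℓ^∞` is represented on the null sequences by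
an absolutely summable sequence. -/
theorem exists_summable_hasSum_of_bounded (g : lp (fun _ : ℕ => 𝕜) ∞ →ₗ[𝕜] 𝕜) (C : ℝ)
    (hg : ∀ a, ‖g a‖ ≤ C * ‖a‖) :
    ∃ l : ℕ → 𝕜, Summable (fun n => ‖l n‖) ∧
      ∀ a : lp (fun _ : ℕ => 𝕜) ∞, Tendsto (fun n => a n) atTop (𝓝 0) →
        HasSum (fun n => l n * a n) (g a) := by
  let e : ℕ → 𝕜 → lp (fun _ : ℕ => 𝕜) ∞ := fun n c => lp.single ∞ n c
  have he : ∀ n c, g (e n c) = g (e n 1) * c := fun n c => by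
    have : e n c = c • e n 1 := by
      simp only [e]; rw [← lp.single_smul]; simp
    rw [this, map_smul, smul_eq_mul, mul_comm]
  have hsum : ∀ (s : Finset ℕ) (c : ℕ → 𝕜) (k : ℕ),
      (∑ n ∈ s, e n (c n) : lp (fun _ : ℕ => 𝕜) ∞) k = if k ∈ s then c k else 0 := by
    intro s c k
    rw [lp.coeFn_sum, Finset.sum_apply]
    simp [e, lp.single_apply, Pi.single_apply]
  have hC : 0 ≤ C := by
    have := (norm_nonneg _).trans (hg (e 0 1))
    rwa [lp.norm_single (by simp), norm_one, mul_one] at this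
  refine ⟨fun n => g (e n 1), ?_, fun a ha => ?_⟩
  · refine summable_of_sum_le (c := C) (fun _ => norm_nonneg _) fun s => ?_
    -- Testing `g` on the finitely supported sequence of conjugate phases bounds `∑ ‖l n‖`.
    let c : ℕ → 𝕜 := fun n => (starRingEnd 𝕜) (g (e n 1)) / ‖g (e n 1)‖
    have hc : ∀ n, g (e n 1) * c n = (‖g (e n 1)‖ : 𝕜) := fun n => by
      rcases eq_or_ne (g (e n 1)) 0 with h | h
      · simp [h]
      · have : (‖g (e n 1)‖ : 𝕜) ≠ 0 := by simpa using h
        simp only [c]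
        rw [mul_div_assoc', RCLike.mul_conj]
        field_simp
    have hc1 : ∀ n, ‖c n‖ ≤ 1 := fun n => by
      simp only [c, norm_div, RCLike.norm_conj, RCLike.norm_ofReal, abs_norm]
      exact div_self_le_one _
    have h1 : g (∑ n ∈ s, e n (c n)) = ((∑ n ∈ s, ‖g (e n 1)‖ : ℝ) : 𝕜) := by
      rw [map_sum, RCLike.ofReal_sum]
      exact Finset.sum_congr rfl fun n _ => by rw [he, hc]
    have h2 : ‖(∑ n ∈ s, e n (c n) : lp (fun _ : ℕ => 𝕜) ∞)‖ ≤ 1 :=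
      lp.norm_le_of_forall_le zero_le_one fun k => by
        rw [hsum]; split_ifs
        · exact hc1 k
        · simp
    have h3 := (hg (∑ n ∈ s, e n (c n))).trans (mul_le_of_le_one_right hC h2)
    rw [h1, RCLike.norm_ofReal] at h3
    exact (le_abs_self _).trans h3
  · rw [HasSum, Metric.tendsto_nhds]
    intro ε hε
    obtain ⟨N, hN⟩ := Metric.tendsto_atTop.1 ha (ε / (C + 1)) (by positivity)
    filter_upwards [eventually_ge_atTop (Finset.range N)] with s hs
    have h1 : ∑ n ∈ s, g (e n 1) * a n - g a = g (∑ n ∈ s, e n (a n) - a) := by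
      rw [map_sub, map_sum]
      simp only [he _ (a _)]
    have h2 : ‖(∑ n ∈ s, e n (a n) - a : lp (fun _ : ℕ => 𝕜) ∞)‖ ≤ ε / (C + 1) :=
      lp.norm_le_of_forall_le (by positivity) fun k => by
        rw [lp.coeFn_sub, Pi.sub_apply, hsum]
        split_ifs with hk
        · simp; positivity
        · have : N ≤ k := by
            by_contra h
            exact hk (hs (Finset.mem_range.2 (not_le.1 h)))
          simpa using (hN k this).le
    show dist (∑ n ∈ s, g (e n 1) * a n) (g a) < ε
    rw [dist_eq_norm, h1]
    refine ((hg _).trans (mul_le_mul_of_nonneg_left h2 hC)).trans_lt ?_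
    rw [mul_div_assoc', div_lt_iff₀ (by positivity)]
    nlinarith

/-- An absolutely summable sequence is the product of an absolutely summable sequence and a null
sequence. -/
theorem exists_mul_tendsto_zero_of_summable (l : ℕ → 𝕜) (hl : Summable fun n => ‖l n‖) :
    ∃ (w : ℕ → ℝ) (u : ℕ → 𝕜), Tendsto w atTop (𝓝 0) ∧ (Summable fun n => ‖u n‖) ∧
      ∀ n, l n = (w n : 𝕜) * u n := by
  -- The null sequence is the square root of the tail sums `r n`.
  let r : ℕ → ℝ := fun n => ∑' k, ‖l (k + n)‖
  have hr0 : ∀ n, 0 ≤ r n := fun n => tsum_nonneg fun _ => norm_nonneg _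
  have hr : ∀ n, r n = ‖l n‖ + r (n + 1) := fun n => by
    have := ((summable_nat_add_iff n).2 hl).tsum_eq_zero_add
    simpa [r, add_assoc, add_comm 1 n] using this
  have hrt : Tendsto r atTop (𝓝 0) := tendsto_sum_nat_add fun n => ‖l n‖
  let w : ℕ → ℝ := fun n => √(r n)
  have hw0 : ∀ n, 0 ≤ w n := fun n => Real.sqrt_nonneg _
  have hwr : ∀ n, w n * w n = r n := fun n => Real.mul_self_sqrt (hr0 n)
  have hwt : Tendsto w atTop (𝓝 0) := by simpa using hrt.sqrt
  have hwm : ∀ n, w (n + 1) ≤ w n := fun n =>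
    Real.sqrt_le_sqrt (by rw [hr n]; linarith [norm_nonneg (l n)])
  have hu : ∀ n, ‖l n / (w n : 𝕜)‖ ≤ 2 * (w n - w (n + 1)) := fun n => by
    rw [norm_div, RCLike.norm_ofReal, abs_of_nonneg (hw0 n)]
    rcases (hw0 n).eq_or_lt with h | h
    · rw [← h, div_zero]; linarith [hwm n]
    · rw [div_le_iff₀ h]
      nlinarith [hwr n, hwr (n + 1), hr n, hw0 (n + 1), hwm n]
  refine ⟨w, fun n => l n / w n, hwt, ?_, fun n => ?_⟩
  · refine summable_of_sum_range_le (c := 2 * w 0) (fun _ => norm_nonneg _) fun N => ?_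
    calc ∑ n ∈ Finset.range N, ‖l n / (w n : 𝕜)‖
        ≤ ∑ n ∈ Finset.range N, 2 * (w n - w (n + 1)) := Finset.sum_le_sum fun n _ => hu n
      _ = 2 * (w 0 - w N) := by rw [← Finset.mul_sum, Finset.sum_range_sub']
      _ ≤ 2 * w 0 := by linarith [hw0 N]
  · rcases eq_or_ne (w n) 0 with h | h
    · have h1 : r n = 0 := by rw [← hwr, h, zero_mul]
      have h2 : ‖l n‖ ≤ 0 := by linarith [hr n, hr0 (n + 1)]
      simp [norm_le_zero_iff.1 h2]
    · have : (w n : 𝕜) ≠ 0 := by exact_mod_cast h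
      field_simp

end NullSequences

/-! ### Weak sums in locally complete spaces -/

section LocalCompleteness

/-- Uniform boundedness: a family which is bounded under every functional dominated by a multiple of
the seminorm `q` is bounded for `q`. -/
theorem exists_seminorm_le_of_forall_functional {𝕜 V ι : Type*} [RCLike 𝕜] [AddCommGroup V]
    [Module 𝕜 V] (q : Seminorm 𝕜 V) (x : ι → V)
    (h : ∀ f : V →ₗ[𝕜] 𝕜, (∃ C : ℝ, ∀ v, ‖f v‖ ≤ C * q v) → ∃ C, ∀ i, ‖f (x i)‖ ≤ C) :
    ∃ C, ∀ i, q (x i) ≤ C := by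
  let _ : SeminormedAddCommGroup V := q.toSeminormedAddCommGroup
  let _ : NormedSpace 𝕜 V := { norm_smul_le := fun a b => (map_smul_eq_mul q a b).le }
  -- The dual of the seminormed space `(V, q)` is complete, and the `x i` act on it.
  obtain ⟨C, hC⟩ := banach_steinhaus (g := fun i => NormedSpace.inclusionInDoubleDual 𝕜 V (x i))
    fun f => h f ⟨‖f‖, f.le_opNorm⟩
  refine ⟨C, fun i => ?_⟩
  obtain ⟨g, hg, hgx⟩ := exists_functional_apply_eq_seminorm q (x i)
  let g' : StrongDual 𝕜 V := g.mkContinuous 1 fun v => (hg v).trans (one_mul (q v)).ge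
  have h1 : ‖g'‖ ≤ 1 := g.mkContinuous_norm_le zero_le_one _
  have h2 : ‖g (x i)‖ ≤ C * ‖g'‖ :=
    ((NormedSpace.inclusionInDoubleDual 𝕜 V (x i)).le_of_opNorm_le (hC i) g')
  have hC0 : 0 ≤ C := (norm_nonneg _).trans (hC i)
  rw [hgx, RCLike.norm_ofReal, abs_of_nonneg (apply_nonneg q _)] at h2
  exact h2.trans (mul_le_of_le_one_right hC0 h1)

variable {𝕜 : Type*} [RCLike 𝕜] {E : Type*} [AddCommGroup E] [Module 𝕜 E]

theorem smul_mem_balancedHull {s : Set E} {c : 𝕜} (hc : ‖c‖ ≤ 1) {y : E} (hy : y ∈ s) :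
    c • y ∈ balancedHull 𝕜 s :=
  mem_balancedHull_iff.2 ⟨c, hc, y, hy, rfl⟩

variable [Module ℝ E] [IsScalarTower ℝ 𝕜 E]

theorem sum_smul_mem_smul_convexHull_balancedHull (y : ℕ → E) (u : ℕ → 𝕜) (N : ℕ) :
    ∑ n ∈ Finset.range N, u n • y n ∈
      (∑ n ∈ Finset.range N, ‖u n‖) • convexHull ℝ (balancedHull 𝕜 (Set.range y)) := by
  have hsub : balancedHull 𝕜 (Set.range y) ⊆ convexHull ℝ (balancedHull 𝕜 (Set.range y)) :=
    subset_convexHull _ _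
  induction N with
  | zero =>
    exact ⟨_, hsub (smul_mem_balancedHull (c := 0) (by simp) ⟨0, rfl⟩), by simp⟩
  | succ N ih =>
    rw [Finset.sum_range_succ, Finset.sum_range_succ,
      (convex_convexHull ℝ _).add_smul (Finset.sum_nonneg fun _ _ => norm_nonneg _)
        (norm_nonneg _)]
    refine Set.add_mem_add ih ⟨(u N / ‖u N‖) • y N, hsub ?_, ?_⟩
    · refine smul_mem_balancedHull ?_ ⟨N, rfl⟩
      simp only [norm_div, RCLike.norm_ofReal, abs_norm]
      exact div_self_le_one _
    · show ‖u N‖ • (u N / ‖u N‖) • y N = u N • y N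
      rw [RCLike.real_smul_eq_coe_smul (K := 𝕜), smul_smul]
      rcases eq_or_ne (u N) 0 with h | h
      · simp [h]
      · rw [mul_div_cancel₀]
        simpa using h

variable [TopologicalSpace E] [IsTopologicalAddGroup E] [ContinuousSMul 𝕜 E]
    [LocallyConvexSpace ℝ E]

/-- In a locally complete space, an absolutely summable combination of a weakly bounded sequence
has a weak sum. -/
theorem IsLocallyCompleteSpace.exists_weak_sum (hE : IsLocallyCompleteSpace 𝕜 E) {x : ℕ → E}
    (hx : ∀ χ : StrongDual 𝕜 E, ∃ C, ∀ n, ‖χ (x n)‖ ≤ C) {l : ℕ → 𝕜}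
    (hl : Summable fun n => ‖l n‖) :
    ∃ z : E, ∀ χ : StrongDual 𝕜 E, HasSum (fun n => l n * χ (x n)) (χ z) := by
  have := polynormableSpace_of_locallyConvexSpace_real (𝕜 := 𝕜) (V := E)
  obtain ⟨w, u, hw, hu, hlwu⟩ := exists_mul_tendsto_zero_of_summable l hl
  -- A multiple `w n • x n` of the bounded sequence, with `w n → 0`, is a null sequence.
  let y : ℕ → E := fun n => (w n : 𝕜) • x n
  have hy : Tendsto y atTop (𝓝 0) := by
    rw [(PolynormableSpace.withSeminorms 𝕜 E).tendsto_nhds]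
    rintro ⟨q, hq⟩ ε hε
    obtain ⟨C, hC⟩ := exists_seminorm_le_of_forall_functional q x fun f ⟨C, hf⟩ =>
      hx ⟨f, continuous_linearMap_of_le_seminorm f (C.toNNReal • q) (hq.const_smul _) fun v =>
        (hf v).trans (mul_le_mul_of_nonneg_right (Real.le_coe_toNNReal C) (apply_nonneg q v))⟩
    have h0 : Tendsto (fun n => |w n| * C) atTop (𝓝 0) := by simpa using hw.abs.mul_const C
    filter_upwards [h0.eventually_lt_const hε] with n hn
    refine lt_of_le_of_lt ?_ hn
    simp only [y, sub_zero, map_smul_eq_mul, RCLike.norm_ofReal]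
    exact mul_le_mul_of_nonneg_left (hC n) (abs_nonneg _)
  let C : ℝ := ∑' n, ‖u n‖ + 1
  have hC : 0 < C := add_pos_of_nonneg_of_pos (tsum_nonneg fun _ => norm_nonneg _) one_pos
  let s : ℕ → E := fun N => C⁻¹ • ∑ n ∈ Finset.range N, u n • y n
  have hs : ∀ N, s N ∈ closure (convexHull ℝ (balancedHull 𝕜 (Set.range y))) := fun N => by
    refine subset_closure ?_
    obtain ⟨v, hv, hvs⟩ := sum_smul_mem_smul_convexHull_balancedHull y u N
    simp only [s, ← hvs, smul_smul]
    refine (convex_convexHull ℝ _).smul_mem_of_zero_mem ?_ hv ⟨by positivity, ?_⟩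
    · have := smul_mem_balancedHull (𝕜 := 𝕜) (c := 0) (by simp) (Set.mem_range_self (f := y) 0)
      rw [zero_smul] at this
      exact subset_convexHull _ _ this
    · rw [inv_mul_le_iff₀ hC, mul_one]
      exact (hu.sum_le_tsum _ fun _ _ => norm_nonneg _).trans (by simp [C])
  -- The normalised partial sums stay in a compact set. Any cluster point will do: each functional
  -- maps the partial sums to a convergent sequence, whose only cluster point is its limit.
  obtain ⟨z, -, hz⟩ := (hE y hy).exists_mapClusterPt_of_frequently (l := atTop) (f := s)
    (Frequently.of_forall hs)
  refine ⟨C • z, fun χ => ?_⟩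
  obtain ⟨D, hD⟩ := hx χ
  have hsum : Summable fun n => l n * χ (x n) :=
    Summable.of_norm_bounded (hl.mul_right D) fun n => by
      rw [norm_mul]
      exact mul_le_mul_of_nonneg_left (hD n) (norm_nonneg _)
  have hχs : Tendsto (χ ∘ s) atTop (𝓝 ((C : 𝕜)⁻¹ * ∑' n, l n * χ (x n))) := by
    refine (hsum.hasSum.tendsto_sum_nat.const_mul (C : 𝕜)⁻¹).congr fun N => ?_
    simp only [s, Function.comp_apply, RCLike.real_smul_eq_coe_smul (K := 𝕜), map_smul, map_sum, y,
      smul_eq_mul, RCLike.ofReal_inv, hlwu]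
    congr 1
    exact Finset.sum_congr rfl fun n _ => by ring
  have hzχ : MapClusterPt (χ z) atTop (χ ∘ s) := hz.continuousAt_comp χ.continuous.continuousAt
  have heq : χ z = (C : 𝕜)⁻¹ * ∑' n, l n * χ (x n) := eq_of_nhds_neBot (ClusterPt.mono hzχ hχs)
  have hC' : (C : 𝕜) ≠ 0 := by exact_mod_cast hC.ne'
  have : χ (C • z) = ∑' n, l n * χ (x n) := by
    rw [RCLike.real_smul_eq_coe_smul (K := 𝕜), map_smul, heq, smul_eq_mul,
      mul_inv_cancel_left₀ hC']
  rw [this]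
  exact hsum.hasSum

end LocalCompleteness

/-! ### Compatible topologies on the dual -/

section Mackey

variable (𝕜 : Type*) [RCLike 𝕜] (E : Type*) [AddCommGroup E] [Module 𝕜 E] [TopologicalSpace E]

/-- The evaluations at points of `E`, as a subspace of the algebraic dual of `E'`. -/
def evaluations : Submodule 𝕜 (StrongDual 𝕜 E →ₗ[𝕜] 𝕜) :=
  LinearMap.range (topDualPairing 𝕜 E).flip

variable {𝕜 E}

theorem mem_evaluations {f : StrongDual 𝕜 E →ₗ[𝕜] 𝕜} :
    f ∈ evaluations 𝕜 E ↔ ∃ x : E, ∀ χ : StrongDual 𝕜 E, f χ = χ x := by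
  simp only [evaluations, LinearMap.mem_range, LinearMap.ext_iff]
  exact exists_congr fun x => forall_congr' fun χ => eq_comm

theorem IsCompatibleDualTopology.polynormableSpace {t : TopologicalSpace (StrongDual 𝕜 E)}
    (ht : IsCompatibleDualTopology 𝕜 E t) :
    PolynormableSpace 𝕜 (StrongDual 𝕜 E) (topology := t) := by
  obtain ⟨h1, h2, h3, -⟩ := ht
  exact @polynormableSpace_of_locallyConvexSpace_real 𝕜 _ (StrongDual 𝕜 E) _ _ _ _ t h1 h2 h3

theorem exists_eval_of_continuous_mackey (f : StrongDual 𝕜 E →ₗ[𝕜] 𝕜)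
    (hf : Continuous[mackeyDualTopology 𝕜 E, inferInstance] f) :
    ∃ x : E, ∀ χ : StrongDual 𝕜 E, f χ = χ x := by
  rw [← mem_evaluations]
  rw [mackeyDualTopology, sInf_eq_iInf'] at hf
  exact mem_of_continuous_iInf (V := StrongDual 𝕜 E)
    (t := fun t : {t // IsCompatibleDualTopology 𝕜 E t} => t.1)
    (fun t => t.2.polynormableSpace) (evaluations 𝕜 E)
    (fun t g hg => mem_evaluations.2 ((t.2.2.2.2 g).1 hg)) f hf

variable (𝕜) in
/-- A sequence which tends to `0` in the weak topology. -/
def IsWeaklyNull (x : ℕ → E) : Prop :=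
  ∀ χ : StrongDual 𝕜 E, Tendsto (fun n => χ (x n)) atTop (𝓝 0)

theorem IsWeaklyNull.bounded {x : ℕ → E} (hx : IsWeaklyNull 𝕜 x) (χ : StrongDual 𝕜 E) :
    ∃ C, ∀ n, ‖χ (x n)‖ ≤ C := by
  obtain ⟨C, hC⟩ := (hx χ).norm.bddAbove_range
  exact ⟨C, fun n => hC ⟨n, rfl⟩⟩

/-- The operator `χ ↦ (χ (x n))ₙ` from `E'` to `ℓ^∞`, for a weakly null sequence `x`. -/
noncomputable def IsWeaklyNull.evalSeq {x : ℕ → E} (hx : IsWeaklyNull 𝕜 x) :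
    StrongDual 𝕜 E →ₗ[𝕜] lp (fun _ : ℕ => 𝕜) ∞ where
  toFun χ := ⟨fun n => χ (x n), memℓp_infty (hx χ).norm.bddAbove_range⟩
  map_add' _ _ := rfl
  map_smul' _ _ := rfl

variable (𝕜 E) in
/-- The topology on `E'` of uniform convergence on the weakly null sequences of `E`. -/
noncomputable abbrev weaklyNullTopology : TopologicalSpace (StrongDual 𝕜 E) :=
  ⨅ x : {x : ℕ → E // IsWeaklyNull 𝕜 x}, TopologicalSpace.induced x.2.evalSeq inferInstance

/-- Over a locally complete space, a functional continuous for uniform convergence on a weakly null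
sequence `x` is an evaluation: as a functional on `c₀` it is given by some `l ∈ ℓ¹`, and so it is
the evaluation at the weak sum of `∑ l n • x n`. -/
theorem IsLocallyCompleteSpace.exists_eval_of_continuous_induced [Module ℝ E]
    [IsScalarTower ℝ 𝕜 E] [IsTopologicalAddGroup E] [ContinuousSMul 𝕜 E] [LocallyConvexSpace ℝ E]
    (hE : IsLocallyCompleteSpace 𝕜 E) {x : ℕ → E} (hx : IsWeaklyNull 𝕜 x)
    (f : StrongDual 𝕜 E →ₗ[𝕜] 𝕜)
    (hf : Continuous[TopologicalSpace.induced hx.evalSeq inferInstance, inferInstance] f) :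
    ∃ z : E, ∀ χ : StrongDual 𝕜 E, f χ = χ z := by
  obtain ⟨C, hC⟩ : ∃ C : NNReal, ∀ χ, ‖f χ‖ ≤ C * ‖hx.evalSeq χ‖ := by
    let _ : TopologicalSpace (StrongDual 𝕜 E) := TopologicalSpace.induced hx.evalSeq inferInstance
    obtain ⟨s, C, -, hC⟩ := Seminorm.bound_comp_of_isInducing (p := f.toSeminorm) hf.norm
      (norm_withSeminorms 𝕜 (lp (fun _ : ℕ => 𝕜) ∞)) (f := hx.evalSeq) ⟨rfl⟩
    refine ⟨C, fun χ => (hC χ).trans (mul_le_mul_of_nonneg_left ?_ C.2)⟩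
    exact Seminorm.finset_sup_apply_le (norm_nonneg _) fun _ _ => le_rfl
  obtain ⟨g, hg, hgf⟩ := exists_factor_of_le_seminorm f hx.evalSeq
    (C • normSeminorm 𝕜 (lp (fun _ : ℕ => 𝕜) ∞)) hC
  obtain ⟨l, hl, hlg⟩ := exists_summable_hasSum_of_bounded g C hg
  obtain ⟨z, hz⟩ := hE.exists_weak_sum hx.bounded hl
  exact ⟨z, fun χ => by rw [← hgf]; exact (hlg _ (hx χ)).unique (hz χ)⟩

/-- These sequences `y, 0, 0, …` make all evaluations continuous for `weaklyNullTopology`. -/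
theorem isWeaklyNull_ite (y : E) : IsWeaklyNull 𝕜 fun n => if n = 0 then y else 0 := fun χ =>
  tendsto_const_nhds.congr' (by
    filter_upwards [eventually_ne_atTop 0] with n hn
    simp [hn])

variable [Module ℝ E] [IsScalarTower ℝ 𝕜 E] [IsTopologicalAddGroup E] [ContinuousSMul 𝕜 E]
  [LocallyConvexSpace ℝ E]

theorem IsLocallyCompleteSpace.isCompatible_weaklyNullTopology
    (hE : IsLocallyCompleteSpace 𝕜 E) : IsCompatibleDualTopology 𝕜 E (weaklyNullTopology 𝕜 E) := by
  refine ⟨topologicalAddGroup_iInf fun x => topologicalAddGroup_induced _,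
    continuousSMul_iInf fun x => continuousSMul_induced _,
    LocallyConvexSpace.iInf fun x => ?_, fun f => ⟨fun hf => ?_, ?_⟩⟩
  · exact LocallyConvexSpace.induced (𝕜 := ℝ) (x.2.evalSeq.restrictScalars ℝ)
  · rw [← mem_evaluations]
    exact mem_of_continuous_iInf (V := StrongDual 𝕜 E)
      (t := fun x : {x : ℕ → E // IsWeaklyNull 𝕜 x} =>
        TopologicalSpace.induced x.2.evalSeq inferInstance)
      (fun x => PolynormableSpace.induced x.2.evalSeq) (evaluations 𝕜 E)
      (fun x g hg => mem_evaluations.2 (hE.exists_eval_of_continuous_induced x.2 g hg)) f hf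
  · rintro ⟨y, hy⟩
    refine continuous_iInf_dom (i := ⟨_, isWeaklyNull_ite y⟩) ?_
    have hf : ⇑f = lp.evalCLM 𝕜 (fun _ : ℕ => 𝕜) ∞ 0 ∘ (isWeaklyNull_ite (𝕜 := 𝕜) y).evalSeq :=
      funext hy
    rw [hf]
    let _ : TopologicalSpace (StrongDual 𝕜 E) :=
      TopologicalSpace.induced (isWeaklyNull_ite (𝕜 := 𝕜) y).evalSeq inferInstance
    have h : IsInducing (isWeaklyNull_ite (𝕜 := 𝕜) y).evalSeq := ⟨rfl⟩
    exact (lp.evalCLM 𝕜 (fun _ : ℕ => 𝕜) ∞ 0).continuous.comp h.continuous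

theorem IsLocallyCompleteSpace.mackeyDualTopology_le (hE : IsLocallyCompleteSpace 𝕜 E) :
    mackeyDualTopology 𝕜 E ≤ weaklyNullTopology 𝕜 E :=
  sInf_le hE.isCompatible_weaklyNullTopology

end Mackey

/-! ### Summable sequences of functionals -/

section Sequences

theorem IsEllSeq.tendsto_zero {𝕜 : Type*} [RCLike 𝕜] {p : ℝ≥0∞} (hp : 1 ≤ p) {a : ℕ → 𝕜}
    (ha : IsEllSeq p a) : Tendsto a atTop (𝓝 0) := by
  rcases eq_or_ne p ∞ with h | h
  · exact ha.2 h
  · have hp0 : 0 < p.toReal := ENNReal.toReal_pos (zero_lt_one.trans_le hp).ne' h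
    have h1 := ((ha.1 h).summable hp0).tendsto_atTop_zero.rpow_const
      (p := p.toReal⁻¹) (Or.inr (inv_nonneg.2 hp0.le))
    rw [Real.zero_rpow (inv_pos.2 hp0).ne'] at h1
    refine tendsto_zero_iff_norm_tendsto_zero.2 (h1.congr fun n => ?_)
    exact Real.rpow_rpow_inv (norm_nonneg _) hp0.ne'

/-- Weak* `p`-summability is `p`-summability at every point, because the evaluations are the only
weak* continuous functionals. -/
theorem isWeaklyPSummable_weakDual_iff {𝕜 : Type*} [RCLike 𝕜] {X : Type*} [AddCommGroup X]
    [Module 𝕜 X] [TopologicalSpace X] {p : ℝ≥0∞} {χ : ℕ → WeakDual 𝕜 X} :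
    IsWeaklyPSummable 𝕜 p χ ↔ ∀ h : X, IsEllSeq p fun n => χ n h := by
  constructor
  · intro H h
    exact H (WeakBilin.eval (topDualPairing 𝕜 X) h)
  · intro H ψ
    obtain ⟨h, rfl⟩ := LinearMap.dualEmbedding_surjective (topDualPairing 𝕜 X) ψ
    exact H h

end Sequences

/-! ### Total boundedness under duality -/

section TotalBoundedness

/-- The duality step: if `K` is totally bounded for the uniform distance over `B`, and
`B` is pointwise bounded, then `B` is totally bounded for the uniform distance over `K`. -/
theorem exists_finite_approx_swap {𝕜 X Y : Type*} [RCLike 𝕜] (a : Y → X → 𝕜) {K : Set X}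
    {B : Set Y}
    (hK : ∀ ε > 0, ∃ F : Set X, F.Finite ∧ ∀ x ∈ K, ∃ y ∈ F, ∀ b ∈ B, ‖a b x - a b y‖ ≤ ε)
    (hB : ∀ x, ∃ C, ∀ b ∈ B, ‖a b x‖ ≤ C) {ε : ℝ} (hε : 0 < ε) :
    ∃ G ⊆ B, G.Finite ∧ ∀ b ∈ B, ∃ g ∈ G, ∀ x ∈ K, ‖a b x - a g x‖ ≤ ε := by
  obtain ⟨F, hF, hFK⟩ := hK (ε / 3) (by positivity)
  have := hF.fintype
  let R : Y → F → 𝕜 := fun b x => a b x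
  have hbd : Bornology.IsBounded (R '' B) := by
    rw [← Bornology.forall_isBounded_image_eval_iff]
    intro x
    obtain ⟨C, hC⟩ := hB x
    refine isBounded_iff_forall_norm_le.2 ⟨C, ?_⟩
    rintro _ ⟨_, ⟨b, hb, rfl⟩, rfl⟩
    exact hC b hb
  obtain ⟨T, hTB, hT, hcov⟩ :=
    Metric.finite_approx_of_totallyBounded
      (hbd.isCompact_closure.totallyBounded.subset subset_closure) (ε / 3) (by positivity)
  obtain ⟨G, hGB, hG, hGT⟩ : ∃ G ⊆ B, G.Finite ∧ T = R '' G :=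
    Set.exists_subset_image_finite_and.1 ⟨T, hTB, hT, rfl⟩
  refine ⟨G, hGB, hG, fun b hb => ?_⟩
  obtain ⟨_, hcT, hbc⟩ := Set.mem_iUnion₂.1 (hcov ⟨b, hb, rfl⟩)
  rw [hGT] at hcT
  obtain ⟨g, hg, rfl⟩ := hcT
  refine ⟨g, hg, fun x hx => ?_⟩
  obtain ⟨y, hy, hxy⟩ := hFK x hx
  have h1 := hxy b hb
  have h2 := hxy g (hGB hg)
  have h3 : ‖a b y - a g y‖ ≤ ε / 3 := by
    have := (dist_le_pi_dist (R b) (R g) ⟨y, hy⟩).trans (Metric.mem_ball.1 hbc).le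
    rwa [dist_eq_norm] at this
  calc ‖a b x - a g x‖ = ‖(a b x - a b y) + (a b y - a g y) - (a g x - a g y)‖ := by
        congr 1; ring
    _ ≤ ‖a b x - a b y‖ + ‖a b y - a g y‖ + ‖a g x - a g y‖ :=
        (norm_sub_le _ _).trans (add_le_add_left (norm_add_le _ _) _)
    _ ≤ ε := by linarith

/-- If every sequence in `K` has a subsequence which converges uniformly over `B`, then `K` is
totally bounded for the uniform distance over `B`. -/
theorem exists_finite_approx_of_subseq {𝕜 X Y : Type*} [RCLike 𝕜] (a : Y → X → 𝕜) {K : Set X}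
    {B : Set Y}
    (h : ∀ x : ℕ → X, (∀ n, x n ∈ K) → ∃ (z : X) (φ : ℕ → ℕ), StrictMono φ ∧
      ∀ ε > 0, ∀ᶠ n in atTop, ∀ b ∈ B, ‖a b (x (φ n)) - a b z‖ ≤ ε) {ε : ℝ} (hε : 0 < ε) :
    ∃ F : Set X, F.Finite ∧ ∀ x ∈ K, ∃ y ∈ F, ∀ b ∈ B, ‖a b x - a b y‖ ≤ ε := by
  by_contra! hcon
  -- Otherwise `K` contains a sequence which is `ε`-separated for the uniform distance over `B`.
  obtain ⟨x, hxK, hx⟩ := exists_seq_of_forall_finset_exists (fun x => x ∈ K)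
    (fun y x => ∃ b ∈ B, ε < ‖a b x - a b y‖) fun s _ => hcon s s.finite_toSet
  obtain ⟨z, φ, hφ, hz⟩ := h x hxK
  obtain ⟨N, hN⟩ := eventually_atTop.1 (hz (ε / 2) (by positivity))
  obtain ⟨b, hb, hlt⟩ := hx _ _ (hφ (Nat.lt_succ_self N))
  have h1 := hN N le_rfl b hb
  have h2 := hN (N + 1) N.le_succ b hb
  have h3 := norm_sub_le (a b (x (φ (N + 1))) - a b z) (a b (x (φ N)) - a b z)
  rw [sub_sub_sub_cancel_right] at h3
  linarith

end TotalBoundedness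

/-! ### Weak compactness of polars -/

section WeakCompactness

/-- **Alaoglu–Bourbaki**: if every functional dominated by the seminorm `q` on `E'` is an
evaluation, then the polar of the unit ball of `q` is weakly compact in `E`. -/
theorem isCompact_polar_of_forall_eval {𝕜 : Type*} [RCLike 𝕜] {E : Type*} [AddCommGroup E]
    [Module 𝕜 E] [TopologicalSpace E] (q : Seminorm 𝕜 (StrongDual 𝕜 E))
    (hq : ∀ f : StrongDual 𝕜 E →ₗ[𝕜] 𝕜, (∀ χ, ‖f χ‖ ≤ q χ) → ∃ x : E, ∀ χ, f χ = χ x) :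
    IsCompact (toWeakSpace 𝕜 E '' {x : E | ∀ χ : StrongDual 𝕜 E, ‖χ x‖ ≤ q χ}) := by
  let J : WeakSpace 𝕜 E → StrongDual 𝕜 E → 𝕜 := fun x χ => (topDualPairing 𝕜 E).flip x χ
  have hJ : IsInducing J := ⟨rfl⟩
  rw [hJ.isCompact_iff]
  have himg : J '' (toWeakSpace 𝕜 E '' {x : E | ∀ χ : StrongDual 𝕜 E, ‖χ x‖ ≤ q χ}) =
      (Set.univ.pi fun χ => Metric.closedBall 0 (q χ)) ∩
        ({F | ∀ χ ψ, F (χ + ψ) = F χ + F ψ} ∩ {F | ∀ (c : 𝕜) χ, F (c • χ) = c • F χ}) := by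
    ext F
    constructor
    · rintro ⟨_, ⟨x, hx, rfl⟩, rfl⟩
      exact ⟨fun χ _ => mem_closedBall_zero_iff.2 (hx χ), fun _ _ => rfl, fun _ _ => rfl⟩
    · rintro ⟨h1, h2, h3⟩
      have hF : ∀ χ, ‖F χ‖ ≤ q χ := fun χ => mem_closedBall_zero_iff.1 (h1 χ trivial)
      obtain ⟨x, hx⟩ := hq { toFun := F, map_add' := h2, map_smul' := h3 } hF
      refine ⟨_, ⟨x, fun χ => ?_, rfl⟩, ?_⟩
      · rw [← hx χ]
        exact hF χ
      · exact funext fun χ => (hx χ).symm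
  rw [himg]
  refine (isCompact_univ_pi fun χ => isCompact_closedBall _ _).inter_right (IsClosed.inter ?_ ?_)
  · simp only [Set.ofPred_forall]
    exact isClosed_iInter fun χ => isClosed_iInter fun ψ =>
      isClosed_eq (continuous_apply _) ((continuous_apply χ).add (continuous_apply ψ))
  · simp only [Set.ofPred_forall]
    exact isClosed_iInter fun c => isClosed_iInter fun χ =>
      isClosed_eq (continuous_apply _) ((continuous_apply _).const_smul c)

end WeakCompactness

/-! ### Precompact and limited sets in the Mackey dual -/

namespace MackeyDual

variable {𝕜 : Type*} [RCLike 𝕜] {E : Type*} [AddCommGroup E] [Module 𝕜 E] [TopologicalSpace E]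

/-- The identity map from `(E', μ(E', E))` to `E'`. -/
noncomputable def toDual : MackeyDual 𝕜 E ≃ₗ[𝕜] StrongDual 𝕜 E :=
  LinearEquiv.refl 𝕜 (StrongDual 𝕜 E)

instance : PolynormableSpace 𝕜 (MackeyDual 𝕜 E) :=
  polynormableSpace_of_locallyConvexSpace_real

/-- The **Mackey–Arens theorem**: the dual of `(E', μ(E', E))` consists of evaluations. -/
theorem exists_eval (f : StrongDual 𝕜 (MackeyDual 𝕜 E)) : ∃ x : E, ∀ h, f h = toDual h x :=
  exists_eval_of_continuous_mackey (f.toLinearMap.comp toDual.symm.toLinearMap) f.continuous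

variable [Module ℝ E] [IsScalarTower ℝ 𝕜 E] [IsTopologicalAddGroup E] [ContinuousSMul 𝕜 E]
  [LocallyConvexSpace ℝ E]

/-- The evaluation at a point of a locally complete space, as a Mackey continuous functional. -/
noncomputable def evalCLM (hE : IsLocallyCompleteSpace 𝕜 E) (x : E) :
    StrongDual 𝕜 (MackeyDual 𝕜 E) where
  toLinearMap := ((topDualPairing 𝕜 E).flip x).comp toDual.toLinearMap
  cont := continuous_le_dom hE.mackeyDualTopology_le
    ((hE.isCompatible_weaklyNullTopology.2.2.2 ((topDualPairing 𝕜 E).flip x)).2 ⟨x, fun _ => rfl⟩)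

theorem setOf_forall_norm_le_mem_nhds_zero (hE : IsLocallyCompleteSpace 𝕜 E) {x : ℕ → E}
    (hx : IsWeaklyNull 𝕜 x) {ε : ℝ} (hε : 0 < ε) :
    {h : MackeyDual 𝕜 E | ∀ n, ‖toDual h (x n)‖ ≤ ε} ∈ 𝓝 (0 : MackeyDual 𝕜 E) := by
  have hcont : Continuous fun h : MackeyDual 𝕜 E => hx.evalSeq (toDual h) :=
    continuous_le_dom hE.mackeyDualTopology_le
      (continuous_iInf_dom (i := (⟨x, hx⟩ : {x : ℕ → E // IsWeaklyNull 𝕜 x}))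
        (@continuous_induced_dom _ _ hx.evalSeq _))
  have h0 : ∀ᶠ h in 𝓝 (0 : MackeyDual 𝕜 E), ‖hx.evalSeq (toDual h)‖ < ε :=
    hcont.norm.continuousAt.eventually_lt continuousAt_const (by simpa using hε)
  filter_upwards [h0] with h hh n
  exact (lp.norm_apply_le_norm ENNReal.top_ne_zero (hx.evalSeq (toDual h)) n).trans hh.le

/-- Over a locally complete space, weakly null sequences are Mackey equicontinuous, hence converge
uniformly on precompact sets. -/
theorem isPQLimited_of_isPrecompactSet (hE : IsLocallyCompleteSpace 𝕜 E) {p : ℝ≥0∞} (hp : 1 ≤ p)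
    {B : Set (MackeyDual 𝕜 E)} (hB : B.Nonempty) (hpre : IsPrecompactSet B) :
    IsPQLimited 𝕜 p ∞ B := by
  refine ⟨hB, fun χ hχ => ⟨fun h => absurd rfl h, fun _ => ?_⟩⟩
  rw [isWeaklyPSummable_weakDual_iff] at hχ
  choose x hx using fun n => exists_eval (WeakDual.toStrongDual (χ n))
  have hx' : ∀ n h, χ n h = toDual h (x n) := hx
  have hnull : IsWeaklyNull 𝕜 x := fun h => by
    have := (hχ (toDual.symm h)).tendsto_zero hp
    simpa only [hx', LinearEquiv.apply_symm_apply] using this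
  rw [ENNReal.tendsto_nhds_zero]
  intro ε hε
  rcases eq_or_ne ε ∞ with rfl | hε'
  · simp
  have hδ : 0 < ε.toReal / 2 := half_pos (ENNReal.toReal_pos hε.ne' hε')
  obtain ⟨F, hF, hBF⟩ := hpre _ (setOf_forall_norm_le_mem_nhds_zero hE hnull hδ)
  have hFev : ∀ᶠ n in atTop, ∀ f ∈ F, ‖toDual f (x n)‖ < ε.toReal / 2 :=
    (hF.eventually_all).2 fun f _ => by
      have := (hnull (toDual f)).norm
      rw [norm_zero] at this
      exact this.eventually_lt_const hδ
  filter_upwards [hFev] with n hn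
  refine iSup₂_le fun b hb => ?_
  rw [← ENNReal.ofReal_toReal hε', ← ofReal_norm]
  refine ENNReal.ofReal_le_ofReal ?_
  rcases hb with hb | rfl
  · obtain ⟨f, hf, u, hu, rfl⟩ := hBF hb
    rw [map_add, hx', hx']
    exact (norm_add_le _ _).trans ((add_le_add (hn f hf).le (hu n)).trans_eq (add_halves _))
  · simp

/-- A `(p, ∞)`-limited set of functionals is uniformly small along weakly `p`-convergent
sequences. -/
theorem eventually_forall_norm_sub_le (hE : IsLocallyCompleteSpace 𝕜 E) {p : ℝ≥0∞}
    {B : Set (MackeyDual 𝕜 E)} (hlim : IsPQLimited 𝕜 p ∞ B) {x : ℕ → E} {z : E}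
    (hx : IsWeaklyPConvergent 𝕜 p x z) {ε : ℝ} (hε : 0 < ε) :
    ∀ᶠ n in atTop, ∀ b ∈ B, ‖toDual b (x n) - toDual b z‖ ≤ ε := by
  let χ : ℕ → WeakDual 𝕜 (MackeyDual 𝕜 E) := fun n =>
    StrongDual.toWeakDual (evalCLM hE (x n - z))
  have hχ : IsWeaklyPSummable 𝕜 p χ :=
    isWeaklyPSummable_weakDual_iff.2 fun h => hx (toDual h)
  have h0 := ENNReal.tendsto_nhds_zero.1 ((hlim.2 χ hχ).2 rfl) (ENNReal.ofReal ε)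
    (ENNReal.ofReal_pos.2 hε)
  filter_upwards [h0] with n hn b hb
  have h1 : ‖χ n b‖ₑ ≤ ENNReal.ofReal ε :=
    (le_iSup₂ (f := fun b (_ : b ∈ B ∪ {0}) => ‖χ n b‖ₑ) b (Or.inl hb)).trans hn
  rw [← ofReal_norm, ENNReal.ofReal_le_ofReal_iff hε.le] at h1
  rw [← map_sub]
  exact h1

/-- A Mackey neighbourhood of zero contains the polar of a weakly compact set `K`. As `K` is
weakly sequentially `p`-compact, it is totally bounded for uniform convergence on a
`(p, ∞)`-limited set `B`; by duality, `B` is totally bounded for uniform convergence on `K`. -/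
theorem isPrecompactSet_of_isPQLimited (hE : IsLocallyCompleteSpace 𝕜 E) {p : ℝ≥0∞}
    (hangelic : IsWeaklySeqPAngelic 𝕜 E p) {B : Set (MackeyDual 𝕜 E)}
    (hbounded : Bornology.IsVonNBounded 𝕜 B) (hlim : IsPQLimited 𝕜 p ∞ B) :
    IsPrecompactSet B := by
  intro U hU
  obtain ⟨q, hq, r, hr, hqU⟩ := exists_continuous_seminorm_of_mem_nhds_zero (𝕜 := 𝕜) hU
  let q' : Seminorm 𝕜 (StrongDual 𝕜 E) := q.comp toDual.symm.toLinearMap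
  have heval : ∀ f : StrongDual 𝕜 E →ₗ[𝕜] 𝕜, (∀ χ, ‖f χ‖ ≤ q' χ) → ∃ x : E, ∀ χ, f χ = χ x :=
    fun f hf => exists_eval_of_continuous_mackey f
      (continuous_linearMap_of_le_seminorm (f.comp (toDual (𝕜 := 𝕜) (E := E)).toLinearMap) q hq
        fun h => hf (toDual h))
  let K : Set E := {x | ∀ χ : StrongDual 𝕜 E, ‖χ x‖ ≤ q' χ}
  have hK : IsRelWeaklySeqPCompact 𝕜 p K :=
    (hangelic K).2 (isCompact_polar_of_forall_eval q' heval).closure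
  have hptw : ∀ x : E, ∃ C, ∀ b ∈ B, ‖toDual b x‖ ≤ C := fun x => by
    obtain ⟨C, hC⟩ := isBounded_iff_forall_norm_le.1
      ((NormedSpace.isVonNBounded_iff 𝕜).1 (hbounded.image (evalCLM hE x)))
    exact ⟨C, fun b hb => hC _ ⟨b, hb, rfl⟩⟩
  obtain ⟨G, hGB, hG, hBG⟩ := exists_finite_approx_swap (fun (b : MackeyDual 𝕜 E) x => toDual b x)
    (K := K) (fun ε hε => exists_finite_approx_of_subseq _ (fun x hx => by
      obtain ⟨z, φ, hφ, hz⟩ := hK x hx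
      exact ⟨z, φ, hφ, fun ε hε => eventually_forall_norm_sub_le hE hlim hz hε⟩) hε)
    hptw (half_pos hr)
  refine ⟨G, hG, fun b hb => ?_⟩
  obtain ⟨g, hg, hbg⟩ := hBG b hb
  refine ⟨g, hg, b - g, hqU _ ?_, add_sub_cancel _ _⟩
  -- By Hahn–Banach, `q` is the supremum over `K` of the evaluations.
  obtain ⟨f, hfq, hf⟩ := exists_functional_apply_eq_seminorm q' (toDual (b - g))
  obtain ⟨x, hx⟩ := heval f hfq
  have h1 : ‖toDual (b - g) x‖ = q (b - g) := by
    rw [← hx, hf, RCLike.norm_ofReal, abs_of_nonneg (apply_nonneg q' _)]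
    rfl
  have h2 := hbg x fun χ => by rw [← hx]; exact hfq χ
  rw [← h1, map_sub]
  exact h2.trans_lt (half_lt_self hr)

end MackeyDual

theorem theoremt {𝕜 : Type*} [RCLike 𝕜] {E : Type*} [AddCommGroup E] [Module 𝕜 E] [Module ℝ E]
    [IsScalarTower ℝ 𝕜 E] [TopologicalSpace E] [IsTopologicalAddGroup E] [ContinuousSMul 𝕜 E]
    [LocallyConvexSpace ℝ E] [T2Space E]
    (p : ℝ≥0∞) (hp : 1 ≤ p)
    (hangelic : IsWeaklyPAngelic 𝕜 E p) (hcomplete : IsLocallyCompleteSpace 𝕜 E)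
    (B : Set (MackeyDual 𝕜 E)) (hB : B.Nonempty) (hbounded : Bornology.IsVonNBounded 𝕜 B) :
    IsPrecompactSet B ↔ IsPQLimited 𝕜 p ∞ B :=
  ⟨MackeyDual.isPQLimited_of_isPrecompactSet hcomplete hp hB,
    MackeyDual.isPrecompactSet_of_isPQLimited hcomplete hangelic.1 hbounded⟩
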